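/- Let $\Sigma$ be a connected three-dimensional real-analytic (Hausdorff) manifold. An \emph{edge} is an analytic curve $[0,1]\to\Sigma$ with nowhere vanishing velocity and without self-intersections (except that it may be closed), taken up to orientation-preserving analytic reparametrization. A \emph{graph} $\gamma$ is a finite set $E(\gamma)$ of edges, distinct ones of which meet at most in their endpoints. A \emph{generalized $U(1)$ connection} is a map $A$ from edges to $U(1)$ with $A(e_1\circ e_2)=A(e_1)A(e_2)$ and $A(e^{-1})=A(e)^{-1}$; the space $\overline{\mathcal A}_{U(1)}$ of all of them carries the $\sigma$-algebra generated by the maps $A\mapsto A(e)$. A positive normalized measure $\mu$ on $\overline{\mathcal A}_{U(1)}$ is \emph{factorizing} with single-edge densities $f_e:U(1)\to[0,\infty)$ if for every graph $\gamma$ with edges $e_1,\dots,e_n$ the joint law of $(A(e_1),\dots,A(e_n))$ under $\mu$ has the density $f_\gamma(g_1,\dots,g_n)=\prod_{i=1}^n f_{e_i}(g_i)$ with respect to normalized Haar measure on $U(1)^n$. Let $S\subset\Sigma$ be an analytically embedded, simply connected surface without boundary, with a transversal orientation (which gives the sign of the intersection of $S$ with a curve, $0$ at tangential intersections). For an edge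 $e$ with finitely many transversal intersections with $S$ put $I(S,e)=P_+-P_-+\tfrac12(I_+-I_-)$, where $P_\pm$ is the number of positive/negative transversal intersections in the interior of $e$ and $I_\pm$ the number of those at the start or end of $e$. For a smooth cylindrical function $c(A)=F(A(e_1),\dots,A(e_n))$, where $e_1,\dots,e_n$ are the edges of a graph and $F\in C^\infty(U(1)^n,\mathbb C)$, put $X_S c=\sum_i I(S,e_i)\,\partial_{\varphi_i}F$ (up to a fixed constant factor) and $\Delta_S(c)=\int\overline{iX_S c}\,d\mu$. The surface $S$ is \emph{admissible} for $\mu$ if there is a constant $C$ with $|\Delta_S(c)|\le C\,\|c\|_{L^2(\mu)}$ for all smooth cylindrical functions $c$ on graphs whose edges have finitely many transversal intersections with $S$. \textbf{Proposition.} Let $\mu$ be a positive, normalized, factorizing measure on $\overline{\mathcal A}_{U(1)}$ with single-edge densities $f_e$, and let $S$ be admissible for $\mu$. Fix a relative orientation $s\in\{+,-\}$ and let $\mathcal E$ be a set of edges, each of which meets $S$ in exactly one point and there with relative orientation $s$, such that no two distinct members of $\mathcal E$ overlap near $S$, i.e. there are no two distinct $e,e'\in\mathcal E$ with common points off $S$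 arbitrarily close to a point of $S$. (This holds, for example, if any two distinct members of $\mathcal E$ meet at most in their endpoints, or in finitely many points.) Then at most countably many $e\in\mathcal E$ have $f_e\neq1$ (as a density, i.e. on a set of positive Haar measure). -/

import Mathlib

open MeasureTheory Set Filter Topology
open scoped Manifold ContDiff

noncomputable section

namespace GenU1

/-- The model space of the three-dimensional manifold. -/
abbrev E3 : Type := EuclideanSpace ℝ (Fin 3)

/-- The gauge group `U(1)`, written additively as `ℝ / 2πℤ` through `g = exp (iφ)`;
its normalized Haar measure `dφ / 2π` is `AddCircle.haarAddCircle`. -/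
abbrev U1 : Type := AddCircle (2 * Real.pi)

instance : Fact (0 < 2 * Real.pi) := ⟨Real.two_pi_pos⟩

/-- The parameter interval of edges. -/
abbrev I01 : Set ℝ := Icc (0 : ℝ) 1

section Geometry

variable {M : Type*} [TopologicalSpace M] [ChartedSpace E3 M]

/-- The velocity at time `t` of a curve with parameter interval `[0,1]`
(one-sided at the two ends). -/
def velocity (c : ℝ → M) (t : ℝ) : TangentSpace 𝓘(ℝ, E3) (c t) :=
  mfderivWithin 𝓘(ℝ, ℝ) 𝓘(ℝ, E3) c I01 t (1 : ℝ)

variable (M) in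
/-- A parametrized edge: an analytic curve `[0,1] → M` with nowhere vanishing velocity and without
self-intersections, except that it may be closed. Values outside `[0,1]` play no role. -/
structure ParamEdge where
  toFun : ℝ → M
  analytic : ContMDiffOn 𝓘(ℝ, ℝ) 𝓘(ℝ, E3) ω toFun I01
  velocity_ne : ∀ t ∈ I01, velocity toFun t ≠ 0
  simple : ∀ s ∈ I01, ∀ t ∈ I01, s < t → toFun s = toFun t → s = 0 ∧ t = 1

/-- `φ` is an analytic, orientation preserving diffeomorphism of `[0,1]` with inverse `ψ`. -/
structure IsReparam (φ ψ : ℝ → ℝ) : Prop where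
  analytic : ContDiffOn ℝ ω φ I01
  analytic_inv : ContDiffOn ℝ ω ψ I01
  mapsTo : MapsTo φ I01 I01
  mapsTo_inv : MapsTo ψ I01 I01
  left_inv : LeftInvOn ψ φ I01
  right_inv : LeftInvOn φ ψ I01
  mono : StrictMonoOn φ I01
  mono_inv : StrictMonoOn ψ I01

theorem IsReparam.refl : IsReparam (fun t => t) (fun t => t) where
  analytic := contDiffOn_id
  analytic_inv := contDiffOn_id
  mapsTo := fun _ h => h
  mapsTo_inv := fun _ h => h
  left_inv := fun _ _ => rfl
  right_inv := fun _ _ => rfl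
  mono := fun _ _ _ _ h => h
  mono_inv := fun _ _ _ _ h => h

theorem IsReparam.symm {φ ψ : ℝ → ℝ} (h : IsReparam φ ψ) : IsReparam ψ φ :=
  ⟨h.analytic_inv, h.analytic, h.mapsTo_inv, h.mapsTo, h.right_inv, h.left_inv,
    h.mono_inv, h.mono⟩

theorem IsReparam.trans {φ ψ φ' ψ' : ℝ → ℝ} (h : IsReparam φ ψ) (h' : IsReparam φ' ψ') :
    IsReparam (φ' ∘ φ) (ψ ∘ ψ') where
  analytic := h'.analytic.comp h.analytic h.mapsTo
  analytic_inv := h.analytic_inv.comp h'.analytic_inv h'.mapsTo_inv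
  mapsTo := h'.mapsTo.comp h.mapsTo
  mapsTo_inv := h.mapsTo_inv.comp h'.mapsTo_inv
  left_inv := fun t ht => by
    simp only [Function.comp_apply]
    rw [h'.left_inv (h.mapsTo ht), h.left_inv ht]
  right_inv := fun t ht => by
    simp only [Function.comp_apply]
    rw [h.right_inv (h'.mapsTo_inv ht), h'.right_inv ht]
  mono := h'.mono.comp h.mono h.mapsTo
  mono_inv := h.mono_inv.comp h'.mono_inv h'.mapsTo_inv

theorem IsReparam.bijOn {φ ψ : ℝ → ℝ} (h : IsReparam φ ψ) : BijOn φ I01 I01 :=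
  InvOn.bijOn ⟨h.left_inv, h.right_inv⟩ h.mapsTo h.mapsTo_inv

theorem IsReparam.map_zero {φ ψ : ℝ → ℝ} (h : IsReparam φ ψ) : φ 0 = 0 := by
  have h0 : (0 : ℝ) ∈ I01 := ⟨le_rfl, zero_le_one⟩
  refine le_antisymm ?_ (h.mapsTo h0).1
  have := h.mono.monotoneOn h0 (h.mapsTo_inv h0) (h.mapsTo_inv h0).1
  rwa [h.right_inv h0] at this

theorem IsReparam.map_one {φ ψ : ℝ → ℝ} (h : IsReparam φ ψ) : φ 1 = 1 := by
  have h1 : (1 : ℝ) ∈ I01 := ⟨zero_le_one, le_rfl⟩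
  refine le_antisymm (h.mapsTo h1).2 ?_
  have := h.mono.monotoneOn (h.mapsTo_inv h1) h1 (h.mapsTo_inv h1).2
  rwa [h.right_inv h1] at this

theorem IsReparam.derivWithin_pos {φ ψ : ℝ → ℝ} (h : IsReparam φ ψ) {t : ℝ} (ht : t ∈ I01) :
    0 < derivWithin φ I01 t := by
  have hu : UniqueDiffWithinAt ℝ I01 t := uniqueDiffOn_Icc_zero_one t ht
  have d1 : HasDerivWithinAt φ (derivWithin φ I01 t) I01 t :=
    ((h.analytic.differentiableOn (by simp)) t ht).hasDerivWithinAt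
  have d2 : HasDerivWithinAt ψ (derivWithin ψ I01 (φ t)) I01 (φ t) :=
    ((h.analytic_inv.differentiableOn (by simp)) _ (h.mapsTo ht)).hasDerivWithinAt
  have d3 := d2.comp t d1 h.mapsTo
  have d4 : HasDerivWithinAt (ψ ∘ φ) 1 I01 t :=
    (hasDerivWithinAt_id t I01).congr (fun x hx => h.left_inv hx) (h.left_inv ht)
  have h1 := hu.eq_deriv _ d3 d4
  have h2 : 0 ≤ derivWithin φ I01 t := h.mono.monotoneOn.derivWithin_nonneg
  rcases h2.lt_or_eq with h2 | h2
  · exact h2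
  · rw [← h2] at h1
    simp at h1

/-- Two parametrized edges define the same edge if they differ by an orientation preserving
analytic reparametrization. -/
instance ParamEdge.setoid : Setoid (ParamEdge M) where
  r p q := ∃ φ ψ : ℝ → ℝ, IsReparam φ ψ ∧ ∀ t ∈ I01, q.toFun t = p.toFun (φ t)
  iseqv :=
    { refl := fun p => ⟨_, _, IsReparam.refl, fun _ _ => rfl⟩
      symm := by
        rintro p q ⟨φ, ψ, h, hpq⟩
        refine ⟨ψ, φ, h.symm, fun t ht => ?_⟩
        rw [hpq _ (h.mapsTo_inv ht), h.right_inv ht]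
      trans := by
        rintro p q r ⟨φ, ψ, h, hpq⟩ ⟨φ', ψ', h', hqr⟩
        refine ⟨_, _, h'.trans h, fun t ht => ?_⟩
        rw [hqr t ht, hpq _ (h'.mapsTo ht), Function.comp_apply] }

variable (M) in
/-- An oriented edge: a parametrized edge up to orientation preserving reparametrization. -/
def Edge : Type _ := Quotient (ParamEdge.setoid (M := M))

/-- The edge of a parametrized edge. -/
def ParamEdge.edge (p : ParamEdge M) : Edge M := Quotient.mk _ p

/-- The points of an edge. -/
def Edge.image (e : Edge M) : Set M :=
  Quotient.lift (fun p : ParamEdge M => p.toFun '' I01) (by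
    rintro p q ⟨φ, ψ, h, hpq⟩
    rw [show q.toFun '' I01 = (fun t => p.toFun (φ t)) '' I01 from image_congr hpq,
      ← image_image p.toFun φ I01, h.bijOn.image_eq]) e

/-- The two endpoints of an edge (one point for a closed edge). -/
def Edge.endpoints (e : Edge M) : Set M :=
  Quotient.lift (fun p : ParamEdge M => ({p.toFun 0, p.toFun 1} : Set M)) (by
    rintro p q ⟨φ, ψ, h, hpq⟩
    rw [hpq 0 ⟨le_rfl, zero_le_one⟩, hpq 1 ⟨zero_le_one, le_rfl⟩, h.map_zero, h.map_one]) e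

/-- `e` is the composition `e₁ ∘ e₂`, that is, `e₁` and `e₂` arise from subdividing `e` at an
interior parameter value `t`, `e₁` being the first part. -/
def Edge.IsComp (e e₁ e₂ : Edge M) : Prop :=
  ∃ p p₁ p₂ : ParamEdge M, p.edge = e ∧ p₁.edge = e₁ ∧ p₂.edge = e₂ ∧
    ∃ t ∈ Ioo (0 : ℝ) 1, ∀ s ∈ I01,
      p₁.toFun s = p.toFun (t * s) ∧ p₂.toFun s = p.toFun (t + (1 - t) * s)

/-- `e'` is `e` run through backwards. -/
def Edge.IsReverse (e e' : Edge M) : Prop :=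
  ∃ p p' : ParamEdge M, p.edge = e ∧ p'.edge = e' ∧ ∀ s ∈ I01, p'.toFun s = p.toFun (1 - s)

variable (M) in
/-- A graph: a finite set of edges, distinct ones of which meet at most in their endpoints. -/
structure Graph where
  edges : Finset (Edge M)
  inter : ∀ e ∈ edges, ∀ e' ∈ edges, e ≠ e' → e.image ∩ e'.image ⊆ e.endpoints ∩ e'.endpoints

variable (M) in
/-- A surface without boundary, analytically embedded in `M`, simply connected and oriented.
Embeddedness is expressed through local defining functions: near each of its points the surface is
the zero set of an analytic function `u` with nonzero differential on the surface. The orientation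
is the transversal one that is needed to give sign to intersections with curves: `conormal q` is
a covector which annihilates the tangent plane at `q`, and the defining functions can be chosen
with differential in the direction of `conormal`. Only the direction of `conormal` matters. -/
structure Surface where
  carrier : Set M
  conormal : (q : M) → TangentSpace 𝓘(ℝ, E3) q →L[ℝ] ℝ
  local_eq : ∀ p ∈ carrier, ∃ (U : Set M) (u : M → ℝ), IsOpen U ∧ p ∈ U ∧
    ContMDiffOn 𝓘(ℝ, E3) 𝓘(ℝ, ℝ) ω u U ∧
    carrier ∩ U = {q ∈ U | u q = 0} ∧
    ∀ q ∈ carrier ∩ U, conormal q ≠ 0 ∧ ∃ a : ℝ, 0 < a ∧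
      ∀ v : TangentSpace 𝓘(ℝ, E3) q,
        (mfderiv 𝓘(ℝ, E3) 𝓘(ℝ, ℝ) u q v : ℝ) = a * conormal q v
  simplyConnected : SimplyConnectedSpace carrier

/-- The sign of a tangent vector `v` at `q` relative to the surface (0 if `v` is tangential). -/
def Surface.sgn (S : Surface M) (q : M) (v : TangentSpace 𝓘(ℝ, E3) q) : SignType :=
  SignType.sign (S.conormal q v)

/-- The relative orientation of the surface and a curve at parameter value `t`. -/
def Surface.orient (S : Surface M) (c : ℝ → M) (t : ℝ) : SignType :=
  S.sgn (c t) (velocity c t)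

theorem Surface.orient_reparam [IsManifold 𝓘(ℝ, E3) ω M] (S : Surface M) {p q : ParamEdge M}
    {φ ψ : ℝ → ℝ} (h : IsReparam φ ψ) (hpq : ∀ t ∈ I01, q.toFun t = p.toFun (φ t))
    {t : ℝ} (ht : t ∈ I01) : S.orient q.toFun t = S.orient p.toFun (φ t) := by
  have hu : UniqueMDiffWithinAt 𝓘(ℝ, ℝ) I01 t :=
    (uniqueDiffOn_Icc_zero_one t ht).uniqueMDiffWithinAt
  have hp : MDifferentiableWithinAt 𝓘(ℝ, ℝ) 𝓘(ℝ, E3) p.toFun I01 (φ t) :=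
    (p.analytic _ (h.mapsTo ht)).mdifferentiableWithinAt (by simp)
  have hφ : DifferentiableWithinAt ℝ φ I01 t := (h.analytic.differentiableOn (by simp)) t ht
  have e1 : mfderivWithin 𝓘(ℝ, ℝ) 𝓘(ℝ, E3) q.toFun I01 t
      = mfderivWithin 𝓘(ℝ, ℝ) 𝓘(ℝ, E3) (p.toFun ∘ φ) I01 t :=
    mfderivWithin_congr hpq (hpq t ht)
  have e2 := mfderivWithin_comp t hp hφ.mdifferentiableWithinAt h.mapsTo hu
  let vq : E3 := velocity q.toFun t
  let vp : E3 := velocity p.toFun (φ t)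
  have e3 : vq = derivWithin φ I01 t • vp := by
    have e4 : (mfderivWithin 𝓘(ℝ, ℝ) 𝓘(ℝ, ℝ) φ I01 t (1 : ℝ) : ℝ)
        = derivWithin φ I01 t • (1 : ℝ) := by
      rw [mfderivWithin_eq_fderivWithin, smul_eq_mul, mul_one]
      rfl
    let L : ℝ →L[ℝ] E3 := mfderivWithin 𝓘(ℝ, ℝ) 𝓘(ℝ, E3) p.toFun I01 (φ t)
    have e5 : vq = L (mfderivWithin 𝓘(ℝ, ℝ) 𝓘(ℝ, ℝ) φ I01 t (1 : ℝ)) :=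
      congrArg (fun L : ℝ →L[ℝ] E3 => L 1) (e1.trans e2)
    rw [e5]
    exact (congrArg L e4).trans (L.map_smul _ _)
  have key : ∀ (x y : M) (v w : E3) (a : ℝ), x = y → v = a • w → 0 < a →
      S.sgn x v = S.sgn y w := by
    rintro x y v w a rfl rfl ha
    unfold Surface.sgn
    have : S.conormal x (a • w : E3) = a * S.conormal x w :=
      ContinuousLinearMap.map_smul (S.conormal x : E3 →L[ℝ] ℝ) a w
    rw [this, sign_mul, sign_pos ha, one_mul]
  exact key _ _ vq vp _ (hpq t ht) e3 (h.derivWithin_pos ht)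

/-- The parameter values in `J` at which a curve crosses the surface with relative
orientation `s`. -/
def Surface.crossings (S : Surface M) (J : Set ℝ) (s : SignType) (c : ℝ → M) : Set ℝ :=
  {t ∈ J | c t ∈ S.carrier ∧ S.orient c t = s}

theorem Surface.crossings_reparam [IsManifold 𝓘(ℝ, E3) ω M] (S : Surface M) (s : SignType)
    {p q : ParamEdge M} {φ ψ : ℝ → ℝ} (h : IsReparam φ ψ)
    (hpq : ∀ t ∈ I01, q.toFun t = p.toFun (φ t)) {J : Set ℝ} (hJ : J ⊆ I01)
    (hφ : BijOn φ J J) :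
    BijOn φ (S.crossings J s q.toFun) (S.crossings J s p.toFun) := by
  refine ⟨?_, hφ.injOn.mono (fun t ht => ht.1), ?_⟩
  · rintro t ⟨ht, h1, h2⟩
    exact ⟨hφ.mapsTo ht, hpq t (hJ ht) ▸ h1, (S.orient_reparam h hpq (hJ ht)) ▸ h2⟩
  · rintro t ⟨ht, h1, h2⟩
    obtain ⟨r, hr, rfl⟩ := hφ.surjOn ht
    exact ⟨r, ⟨hr, (hpq r (hJ hr)).symm ▸ h1, (S.orient_reparam h hpq (hJ hr)).symm ▸ h2⟩, rfl⟩

theorem IsReparam.bijOn_Ioo {φ ψ : ℝ → ℝ} (h : IsReparam φ ψ) :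
    BijOn φ (Ioo (0 : ℝ) 1) (Ioo (0 : ℝ) 1) := by
  have key : ∀ {φ ψ : ℝ → ℝ}, IsReparam φ ψ → MapsTo φ (Ioo (0 : ℝ) 1) (Ioo (0 : ℝ) 1) := by
    intro φ ψ h t ht
    have h0 := h.mono ⟨le_rfl, zero_le_one⟩ (Ioo_subset_Icc_self ht) ht.1
    have h1 := h.mono (Ioo_subset_Icc_self ht) ⟨zero_le_one, le_rfl⟩ ht.2
    rw [h.map_zero] at h0
    rw [h.map_one] at h1
    exact ⟨h0, h1⟩
  exact InvOn.bijOn ⟨h.left_inv.mono Ioo_subset_Icc_self, h.right_inv.mono Ioo_subset_Icc_self⟩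
    (key h) (key h.symm)

theorem IsReparam.bijOn_ends {φ ψ : ℝ → ℝ} (h : IsReparam φ ψ) :
    BijOn φ ({0, 1} : Set ℝ) {0, 1} := by
  have hsub : ({0, 1} : Set ℝ) ⊆ I01 := by
    rintro t (rfl | rfl) <;> simp
  have key : ∀ {φ ψ : ℝ → ℝ}, IsReparam φ ψ → MapsTo φ ({0, 1} : Set ℝ) {0, 1} := by
    rintro φ ψ h t (rfl | rfl)
    · exact Or.inl h.map_zero
    · exact Or.inr h.map_one
  exact InvOn.bijOn ⟨h.left_inv.mono hsub, h.right_inv.mono hsub⟩ (key h) (key h.symm)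

section Intersections

variable [IsManifold 𝓘(ℝ, E3) ω M]

/-- The number of transversal intersections of `e` and `S` in the interior of `e` (the proper
ones), with relative orientation `s`. -/
def Edge.numProper (S : Surface M) (s : SignType) (e : Edge M) : ℕ :=
  Quotient.lift (fun p : ParamEdge M => (S.crossings (Ioo 0 1) s p.toFun).ncard) (by
    rintro p q ⟨φ, ψ, h, hpq⟩
    have b := S.crossings_reparam s h hpq Ioo_subset_Icc_self h.bijOn_Ioo
    change (S.crossings (Ioo 0 1) s p.toFun).ncard = (S.crossings (Ioo 0 1) s q.toFun).ncard
    rw [← b.image_eq, b.injOn.ncard_image]) e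

/-- The number of transversal intersections of `e` and `S` at the start or end of `e`, with
relative orientation `s`. -/
def Edge.numImproper (S : Surface M) (s : SignType) (e : Edge M) : ℕ :=
  Quotient.lift (fun p : ParamEdge M => (S.crossings {0, 1} s p.toFun).ncard) (by
    rintro p q ⟨φ, ψ, h, hpq⟩
    have b := S.crossings_reparam s h hpq (J := {0, 1})
      (by rintro t (rfl | rfl) <;> simp) h.bijOn_ends
    change (S.crossings {0, 1} s p.toFun).ncard = (S.crossings {0, 1} s q.toFun).ncard
    rw [← b.image_eq, b.injOn.ncard_image]) e

/-- The signed intersection number `I(S,e) = P₊ - P₋ + (I₊ - I₋)/2`. -/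
def Edge.intersectionNumber (S : Surface M) (e : Edge M) : ℝ :=
  (e.numProper S 1 : ℝ) - e.numProper S (-1) + ((e.numImproper S 1 : ℝ) - e.numImproper S (-1)) / 2

/-- `e` and `S` have finitely many transversal intersections. -/
def Edge.FinitelyCrosses (S : Surface M) (e : Edge M) : Prop :=
  Quotient.lift (fun p : ParamEdge M =>
      (S.crossings I01 1 p.toFun).Finite ∧ (S.crossings I01 (-1) p.toFun).Finite) (by
    rintro p q ⟨φ, ψ, h, hpq⟩
    have b := fun s => S.crossings_reparam s h hpq Subset.rfl h.bijOn
    change (_ ∧ _) = (_ ∧ _)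
    rw [(b 1).finite_iff_finite, (b (-1)).finite_iff_finite]) e

/-- `e` meets `S` in exactly one point, with relative orientation `s`. -/
def Edge.MeetsOnce (S : Surface M) (s : SignType) (e : Edge M) : Prop :=
  (∃ x, e.image ∩ S.carrier = {x}) ∧
  Quotient.lift (fun p : ParamEdge M =>
      ∀ t ∈ I01, p.toFun t ∈ S.carrier → S.orient p.toFun t = s) (by
    rintro p q ⟨φ, ψ, h, hpq⟩
    refine propext ⟨fun H t ht htS => ?_, fun H t ht htS => ?_⟩
    · rw [S.orient_reparam h hpq ht]
      exact H _ (h.mapsTo ht) (hpq t ht ▸ htS)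
    · obtain ⟨r, hr, rfl⟩ := h.bijOn.surjOn ht
      rw [← S.orient_reparam h hpq hr]
      exact H r hr ((hpq r hr).symm ▸ htS)) e

end Intersections

/-- `e` and `e'` have common points off `S` arbitrarily close to a point of `S`. For two (analytic)
edges which meet `S` in only one point, this means that they have a common segment which contains
that point. -/
def Edge.OverlapNear (S : Surface M) (e e' : Edge M) : Prop :=
  ∃ x ∈ S.carrier, x ∈ closure ((e.image ∩ e'.image) \ S.carrier)

end Geometry

section Measures

variable (M : Type*) [TopologicalSpace M] [ChartedSpace E3 M]

/-- The space of generalized `U(1)` connections: assignments of a holonomy in `U(1)` to every edge,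
compatible with composition and reversal of edges. (It is the projective limit of the spaces
`U(1)^E(γ)` over all graphs `γ`.) -/
def GenConnection : Type _ :=
  {A : Edge M → U1 // (∀ e e₁ e₂, Edge.IsComp e e₁ e₂ → A e = A e₁ + A e₂) ∧
    ∀ e e', Edge.IsReverse e e' → A e' = -A e}

/-- The σ-algebra generated by the holonomies. It is the Baire σ-algebra of the compact space of
generalized connections. -/
instance : MeasurableSpace (GenConnection M) :=
  inferInstanceAs (MeasurableSpace {A : Edge M → U1 //
    (∀ e e₁ e₂, Edge.IsComp e e₁ e₂ → A e = A e₁ + A e₂) ∧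
      ∀ e e', Edge.IsReverse e e' → A e' = -A e})

variable {M}

/-- The holonomies along the edges of a graph. -/
def Graph.hol (γ : Graph M) (A : GenConnection M) : γ.edges → U1 := fun e => A.1 e

/-- `μ` is factorizing with single-edge densities `f`: for every graph `γ`, the joint law of the
holonomies along the edges of `γ` has density `f_γ = ∏ₑ f_e` with respect to Haar measure. -/
structure IsFactorizing (μ : Measure (GenConnection M)) (f : Edge M → U1 → ℝ) : Prop where
  measurable : ∀ e, Measurable (f e)
  nonneg : ∀ e g, 0 ≤ f e g
  law : ∀ γ : Graph M, μ.map γ.hol =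
    (Measure.pi fun _ : γ.edges => (AddCircle.haarAddCircle : Measure U1)).withDensity
      fun g => ENNReal.ofReal (∏ e : γ.edges, f e (g e))

/-- Smooth functions on the torus `U(1)^ι`. -/
def SmoothOnTorus {ι : Type*} [Fintype ι] (F : (ι → U1) → ℂ) : Prop :=
  ContDiff ℝ ∞ fun θ : ι → ℝ => F fun i => (θ i : U1)

open Classical in
/-- The flux vector field `X_S = ∑ₑ I(S,e) ∂/∂φₑ` on functions of the holonomies along the edges of
`γ` (the constant overall factor, half of the coupling constant, is set to one). -/
def fluxField [IsManifold 𝓘(ℝ, E3) ω M] (S : Surface M) (γ : Graph M)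
    (F : (γ.edges → U1) → ℂ) (g : γ.edges → U1) : ℂ :=
  ∑ e : γ.edges, (Edge.intersectionNumber S e.1 : ℂ) *
    deriv (fun θ : ℝ => F (Function.update g e (g e + (θ : U1)))) 0

/-- `S` is admissible with respect to `μ`: the form `Δ_S(c) = ⟨i X_S c, 1⟩` on smooth cylindrical
functions `c` is bounded in the norm of `L²(μ)`. Here `c` runs through the smooth functions of
the holonomies along any graph whose edges cross `S` finitely often, so that `X_S c` is defined. -/
def IsAdmissible [IsManifold 𝓘(ℝ, E3) ω M] (μ : Measure (GenConnection M)) (S : Surface M) : Prop :=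
  ∃ C : ℝ, ∀ γ : Graph M, (∀ e ∈ γ.edges, Edge.FinitelyCrosses S e) →
    ∀ F : (γ.edges → U1) → ℂ, SmoothOnTorus F →
      ‖∫ A, star (Complex.I * fluxField S γ F (γ.hol A)) ∂μ‖
        ≤ C * Real.sqrt (∫ A, ‖F (γ.hol A)‖ ^ 2 ∂μ)

end Measures

end GenU1

end

/-! A density `f e` differs from 1 only if some Fourier coefficient of nonzero order `k` of the law
of the holonomy along `e` is nonzero, so it suffices that for each `k ≠ 0` and `ε > 0` only finitely
many edges of `𝓔` have a coefficient of modulus at least `ε`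
(`IsAdmissible.finite_setOf_le_norm_holCoeff`).

Two facts give this. By factorization the coefficients are multiplicative under subdivision, and
they have modulus at most 1, so passing to a part of an edge never decreases the modulus. Hence `N`
such edges may be replaced by short half-edges issuing from or ending on `S`, so short that they
meet each other at most in their endpoints on `S`: they form a graph in which every edge has
intersection number `s / 2` (`IsFactorizing.exists_graph_of_meetsOnce`).

On this graph admissibility is tested with a sum of centred characters `exp (i k φₑ) - cₑ`, each
times a unimodular phase. The summands are independent, so the square of the `L²` norm is at most
`N`; the phases align the contributions to `Δ_S`, whose modulus is at least `N ε / 2`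
(`IsAdmissible.sum_norm_holCoeff_le`). Linear growth against `√N` bounds `N`. -/

noncomputable section

namespace GenU1

/-! ### Characters and finite measures on the circle. -/

section Torus

theorem fourier_add_apply (k : ℤ) (x y : U1) : fourier k (x + y) = fourier k x * fourier k y := by
  simp [fourier_apply, AddCircle.toCircle_add, smul_add]

theorem norm_fourier_apply (k : ℤ) (x : U1) : ‖fourier k x‖ = 1 := by
  rw [fourier_apply]
  exact Circle.norm_coe _

theorem hasDerivAt_fourier_two_pi (k : ℤ) (x : ℝ) :
    HasDerivAt (fun y : ℝ => fourier k (y : U1)) (Complex.I * k * fourier k (x : U1)) x := by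
  have h := hasDerivAt_fourier (2 * Real.pi) k x
  convert h using 1
  have : (Real.pi : ℂ) ≠ 0 := by exact_mod_cast Real.pi_ne_zero
  push_cast
  field_simp

theorem integrable_continuousMap {α : Type*} [MeasurableSpace α] {μ : Measure α}
    [IsFiniteMeasure μ] {h : α → U1} (hh : Measurable h) (u : C(U1, ℂ)) :
    Integrable (fun x => u (h x)) μ :=
  Integrable.of_bound (u.continuous.measurable.comp hh).aestronglyMeasurable ‖u‖
    (Eventually.of_forall fun _ => u.norm_coe_le_norm _)

/-- A finite measure on the circle is determined by its Fourier coefficients. -/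
theorem ext_of_integral_fourier {μ ν : Measure U1} [IsFiniteMeasure μ] [IsFiniteMeasure ν]
    (h : ∀ k : ℤ, ∫ x, fourier k x ∂μ = ∫ x, fourier k x ∂ν) : μ = ν := by
  have hc : ∀ u : C(U1, ℂ), ∫ x, u x ∂μ = ∫ x, u x ∂ν := by
    -- Integration is Lipschitz in the sup norm with constant the total mass, so the functions with
    -- equal integrals form a closed set; it contains the dense span of the characters.
    have hcont : ∀ (ρ : Measure U1) [IsFiniteMeasure ρ],
        Continuous fun u : C(U1, ℂ) => ∫ x, u x ∂ρ := by
      intro ρ _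
      refine (LipschitzWith.of_dist_le_mul (K := ⟨ρ.real univ, measureReal_nonneg⟩)
        fun u v => ?_).continuous
      rw [dist_eq_norm, ← integral_sub (integrable_continuousMap (h := fun x => x) measurable_id u)
        (integrable_continuousMap (h := fun x => x) measurable_id v)]
      refine (norm_integral_le_of_norm_le_const (Eventually.of_forall fun x => ?_)).trans_eq
        (mul_comm _ _)
      rw [← dist_eq_norm]
      exact ContinuousMap.dist_apply_le_dist x
    intro u
    have hu : u ∈ closure (Submodule.span ℂ (range (fourier (T := 2 * Real.pi))) :
        Set C(U1, ℂ)) := by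
      rw [← Submodule.topologicalClosure_coe, span_fourier_closure_eq_top]
      trivial
    refine closure_minimal (fun v hv => ?_) (isClosed_eq (hcont μ) (hcont ν)) hu
    refine Submodule.span_induction (p := fun v _ => ∫ x, v x ∂μ = ∫ x, v x ∂ν)
      ?_ (by simp) ?_ ?_ hv
    · rintro _ ⟨k, rfl⟩
      exact h k
    · intro v w _ _ hv hw
      simp only [ContinuousMap.add_apply]
      rw [integral_add (integrable_continuousMap (h := fun x => x) measurable_id v)
          (integrable_continuousMap (h := fun x => x) measurable_id w),
        integral_add (integrable_continuousMap (h := fun x => x) measurable_id v)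
          (integrable_continuousMap (h := fun x => x) measurable_id w), hv, hw]
    · intro c v _ hv
      simp only [ContinuousMap.smul_apply, integral_smul, hv]
  refine ext_of_forall_integral_eq_of_IsFiniteMeasure fun u => ?_
  have h1 := hc ⟨fun x => (u x : ℂ), by fun_prop⟩
  simp only [ContinuousMap.coe_mk, integral_complex_ofReal] at h1
  exact_mod_cast h1

end Torus

/-! ### Independence of holonomies and their Fourier coefficients. -/

section Law

variable {M : Type*} [TopologicalSpace M] [ChartedSpace E3 M]

theorem measurable_hol (e : Edge M) : Measurable fun A : GenConnection M => A.1 e :=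
  (measurable_pi_apply e).comp measurable_subtype_coe

theorem Graph.measurable_hol (γ : Graph M) : Measurable γ.hol :=
  measurable_pi_lambda _ fun e => GenU1.measurable_hol e.1

variable {μ : Measure (GenConnection M)} {f : Edge M → U1 → ℝ}

theorem IsFactorizing.integral_prod_density (hf : IsFactorizing μ f) (γ : Graph M)
    (u : Edge M → C(U1, ℂ)) :
    ∫ A, ∏ e ∈ γ.edges, u e (A.1 e) ∂μ =
      ∏ e ∈ γ.edges, ∫ x, (f e x : ℂ) * u e x ∂AddCircle.haarAddCircle := by
  have hm : Measurable fun g : γ.edges → U1 => ENNReal.ofReal (∏ e : γ.edges, f e (g e)) :=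
    (Finset.measurable_prod Finset.univ fun (e : γ.edges) _ =>
      (hf.measurable e).comp (measurable_pi_apply e)).ennreal_ofReal
  have hc : Continuous fun g : γ.edges → U1 => ∏ e : γ.edges, u e (g e) := by fun_prop
  calc ∫ A, ∏ e ∈ γ.edges, u e (A.1 e) ∂μ
      = ∫ A, ∏ e : γ.edges, u e (γ.hol A e) ∂μ := by
        refine integral_congr_ae (Eventually.of_forall fun A => ?_)
        exact (Finset.prod_coe_sort γ.edges fun e => u e (A.1 e)).symm
    _ = ∫ g, ∏ e : γ.edges, u e (g e) ∂(μ.map γ.hol) :=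
        (integral_map γ.measurable_hol.aemeasurable hc.aestronglyMeasurable).symm
    _ = ∫ g : γ.edges → U1, ∏ e : γ.edges, ((f e (g e) : ℂ) * u e (g e))
          ∂(Measure.pi fun _ : γ.edges => (AddCircle.haarAddCircle : Measure U1)) := by
        rw [hf.law γ, integral_withDensity_eq_integral_toReal_smul hm (by simp)]
        refine integral_congr_ae (Eventually.of_forall fun g => ?_)
        simp only []
        rw [ENNReal.toReal_ofReal (Finset.prod_nonneg fun e _ => hf.nonneg _ _),
          Finset.prod_mul_distrib, Complex.real_smul, Complex.ofReal_prod]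
    _ = ∏ e : γ.edges, ∫ x, (f e x : ℂ) * u e x ∂AddCircle.haarAddCircle :=
        integral_fintype_prod_eq_prod (fun (e : γ.edges) (x : U1) => (f e x : ℂ) * u e x)
    _ = _ := Finset.prod_coe_sort γ.edges
        fun e => ∫ x, (f e x : ℂ) * u e x ∂AddCircle.haarAddCircle

/-- The graph with a single edge. -/
def Graph.single (e : Edge M) : Graph M where
  edges := {e}
  inter := by
    intro a ha b hb hab
    rw [Finset.mem_singleton] at ha hb
    exact absurd (ha.trans hb.symm) hab

/-- The one-edge graph identifies `f e` as the density of a single holonomy, so integrals against it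
can be traded for integrals over `μ`. -/
theorem IsFactorizing.integral_density (hf : IsFactorizing μ f) (e : Edge M) (u : C(U1, ℂ)) :
    ∫ x, (f e x : ℂ) * u x ∂AddCircle.haarAddCircle = ∫ A, u (A.1 e) ∂μ := by
  simpa [Graph.single] using (hf.integral_prod_density (Graph.single e) fun _ => u).symm

theorem IsFactorizing.integral_prod (hf : IsFactorizing μ f) (γ : Graph M)
    (u : Edge M → C(U1, ℂ)) :
    ∫ A, ∏ e ∈ γ.edges, u e (A.1 e) ∂μ = ∏ e ∈ γ.edges, ∫ A, u e (A.1 e) ∂μ := by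
  rw [hf.integral_prod_density γ u]
  exact Finset.prod_congr rfl fun e _ => hf.integral_density e (u e)

open Classical in
/-- The holonomies along two edges which meet at most in their endpoints are independent. -/
theorem IsFactorizing.integral_mul (hf : IsFactorizing μ f) {e e' : Edge M} (hne : e ≠ e')
    (h : e.image ∩ e'.image ⊆ e.endpoints ∩ e'.endpoints) (u v : C(U1, ℂ)) :
    ∫ A, u (A.1 e) * v (A.1 e') ∂μ = (∫ A, u (A.1 e) ∂μ) * ∫ A, v (A.1 e') ∂μ := by
  let γ : Graph M :=
    { edges := {e, e'}
      inter := by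
        intro a ha b hb hab
        simp only [Finset.mem_insert, Finset.mem_singleton] at ha hb
        rcases ha with rfl | rfl <;> rcases hb with rfl | rfl
        · exact absurd rfl hab
        · exact h
        · rw [inter_comm, inter_comm (Edge.endpoints _)]
          exact h
        · exact absurd rfl hab }
  have := hf.integral_prod γ fun a => if a = e then u else v
  simpa [γ, Finset.prod_pair hne, hne.symm] using this

/-- The Fourier coefficients of the law of the holonomy along an edge. -/
def holCoeff (μ : Measure (GenConnection M)) (k : ℤ) (e : Edge M) : ℂ :=
  ∫ A, fourier k (A.1 e) ∂μ

theorem norm_holCoeff_le_one [IsProbabilityMeasure μ] (k : ℤ) (e : Edge M) :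
    ‖holCoeff μ k e‖ ≤ 1 := by
  have := norm_integral_le_of_norm_le_const (μ := μ) (C := 1)
    (Eventually.of_forall fun A : GenConnection M => (norm_fourier_apply k (A.1 e)).le)
  simpa only [probReal_univ, mul_one, holCoeff] using this

/-- A law on the circle whose coefficients of nonzero order all vanish is Haar measure, and
densities are unique up to null sets. -/
theorem IsFactorizing.density_eq_one [IsProbabilityMeasure μ] (hf : IsFactorizing μ f)
    {e : Edge M} (h : ∀ k : ℤ, k ≠ 0 → holCoeff μ k e = 0) :
    f e =ᵐ[(AddCircle.haarAddCircle : Measure U1)] fun _ => 1 := by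
  have hm : Measurable fun x => ENNReal.ofReal (f e x) := (hf.measurable e).ennreal_ofReal
  have h1 : ∫ x, (f e x : ℂ) ∂AddCircle.haarAddCircle = 1 := by
    simpa using hf.integral_density e 1
  -- A non-integrable function has integral 0 by convention, which would contradict total mass 1.
  have hint : Integrable (f e) AddCircle.haarAddCircle := by
    by_contra hn
    rw [integral_complex_ofReal, integral_undef hn] at h1
    simp at h1
  have : IsFiniteMeasure ((AddCircle.haarAddCircle : Measure U1).withDensity
      fun x => ENNReal.ofReal (f e x)) :=
    isFiniteMeasure_withDensity_ofReal hint.2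
  have heq : (AddCircle.haarAddCircle : Measure U1).withDensity
      (fun x => ENNReal.ofReal (f e x)) =
        (AddCircle.haarAddCircle : Measure U1).withDensity fun _ => 1 := by
    rw [show (fun _ : U1 => (1 : ENNReal)) = 1 from rfl, withDensity_one]
    refine ext_of_integral_fourier fun k => ?_
    rw [integral_withDensity_eq_integral_toReal_smul hm (by simp)]
    simp only [ENNReal.toReal_ofReal (hf.nonneg _ _), Complex.real_smul]
    rw [hf.integral_density]
    rcases eq_or_ne k 0 with rfl | hk
    · simp
    · rw [show ∫ A, fourier k (A.1 e) ∂μ = 0 from h k hk]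
      -- The Haar integral of a character is its own Fourier coefficient at index 0, which vanishes
      -- for `k ≠ 0`.
      have := fourierCoeff_fourier (T := 2 * Real.pi) k
      have h2 := congrFun this 0
      simpa [fourierCoeff, Pi.single_apply, hk.symm, eq_comm] using h2
  rw [withDensity_eq_iff_of_sigmaFinite hm.aemeasurable aemeasurable_const] at heq
  filter_upwards [heq] with x hx
  simpa using hx

/-- The Fourier coefficients are multiplicative under composition of edges. -/
theorem IsFactorizing.holCoeff_mul (hf : IsFactorizing μ f)
    {e e₁ e₂ : Edge M} (hc : e.IsComp e₁ e₂) (hne : e₁ ≠ e₂)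
    (h : e₁.image ∩ e₂.image ⊆ e₁.endpoints ∩ e₂.endpoints) (k : ℤ) :
    holCoeff μ k e = holCoeff μ k e₁ * holCoeff μ k e₂ := by
  unfold holCoeff
  rw [← hf.integral_mul hne h]
  refine integral_congr_ae (Eventually.of_forall fun A => ?_)
  simp only [A.2.1 e e₁ e₂ hc, fourier_add_apply]

end Law

/-! ### The test function for admissibility: its flux and its norm. -/

section Estimate

variable {M : Type*} [TopologicalSpace M] [ChartedSpace E3 M]

/-- The function `∑ₑ aₑ (exp (i k φₑ) - cₑ)` of the holonomies. -/
def fourierSum (γ : Graph M) (k : ℤ) (a c : Edge M → ℂ) (g : γ.edges → U1) : ℂ :=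
  ∑ e : γ.edges, a e * (fourier k (g e) - c e)

theorem smoothOnTorus_fourierSum (γ : Graph M) (k : ℤ) (a c : Edge M → ℂ) :
    SmoothOnTorus (fourierSum γ k a c) := by
  unfold SmoothOnTorus fourierSum
  simp only [fourier_coe_apply]
  have h : ContDiff ℝ ∞ Complex.ofReal := Complex.ofRealCLM.contDiff
  have h' : ∀ i : γ.edges, ContDiff ℝ ∞ fun θ : γ.edges → ℝ => (θ i : ℂ) := fun i =>
    h.comp (contDiff_apply ℝ ℝ i)
  fun_prop

/-- Each summand depends on one holonomy only, and the constants `c` are killed by differentiation: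
centring the characters, which makes them orthogonal, costs nothing on the flux side. -/
theorem fluxField_fourierSum [IsManifold 𝓘(ℝ, E3) ω M] (S : Surface M) (γ : Graph M) (k : ℤ) (a c : Edge M → ℂ)
    (g : γ.edges → U1) :
    fluxField S γ (fourierSum γ k a c) g =
      ∑ e : γ.edges, (Edge.intersectionNumber S e.1 : ℂ) *
        (a e * (Complex.I * k * fourier k (g e))) := by
  classical
  unfold fluxField
  refine Finset.sum_congr rfl fun e _ => ?_
  congr 1
  refine HasDerivAt.deriv ?_
  have hterm : ∀ e' ∈ (Finset.univ : Finset γ.edges), HasDerivAt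
      (fun θ : ℝ => a e' * (fourier k (Function.update g e (g e + (θ : U1)) e') - c e'))
      (if e' = e then a e * (Complex.I * k * fourier k (g e)) else 0) 0 := by
    intro e' _
    rcases eq_or_ne e' e with rfl | hne
    · simp only [Function.update_self, if_true, fourier_add_apply]
      have h := (((hasDerivAt_fourier_two_pi k 0).const_mul (fourier k (g e'))).sub_const
        (c e')).const_mul (a e')
      refine h.congr_deriv ?_
      rw [show ((0 : ℝ) : U1) = 0 from rfl, fourier_eval_zero]
      ring
    · simp only [Function.update_of_ne hne, if_neg hne]
      exact hasDerivAt_const _ _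
  have := HasDerivAt.fun_sum hterm
  rw [Finset.sum_ite_eq' Finset.univ e, if_pos (Finset.mem_univ _)] at this
  exact this

variable {μ : Measure (GenConnection M)} {f : Edge M → U1 → ℝ}

/-- The functions `exp (i k φₑ) - E exp (i k φₑ)` are orthogonal in `L²(μ)`. -/
theorem IsFactorizing.integral_norm_sq_fourierSum_le [IsProbabilityMeasure μ]
    (hf : IsFactorizing μ f) (γ : Graph M) (k : ℤ) (a : Edge M → ℂ) (ha : ∀ e, ‖a e‖ ≤ 1) :
    ∫ A, ‖fourierSum γ k a (holCoeff μ k) (γ.hol A)‖ ^ 2 ∂μ ≤ γ.edges.card := by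
  let Y : Edge M → C(U1, ℂ) := fun e => a e • (fourier k - ContinuousMap.const _ (holCoeff μ k e))
  have hY0 : ∀ e, ∫ A, Y e (A.1 e) ∂μ = 0 := by
    intro e
    simp only [Y, ContinuousMap.smul_apply, ContinuousMap.sub_apply, ContinuousMap.const_apply,
      integral_smul]
    rw [integral_sub (integrable_continuousMap (measurable_hol e) _) (integrable_const _)]
    simp [holCoeff]
  have hYY : ∀ e, (∫ A, Y e (A.1 e) * star (Y e) (A.1 e) ∂μ).re ≤ 1 := by
    intro e
    -- The square is expanded so that the last term is a multiple of `Y e` and integrates to 0; what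
    -- remains has integral `‖a e‖² (1 - ‖holCoeff μ k e‖²)`.
    have h1 : ∀ A : GenConnection M, Y e (A.1 e) * star (Y e) (A.1 e) =
        ((‖a e‖ ^ 2 : ℝ) : ℂ) * (1 - holCoeff μ k e * star (fourier k) (A.1 e)) -
          star (a e * holCoeff μ k e) * Y e (A.1 e) := by
      intro A
      have h2 : fourier k (A.1 e) * star (fourier k (A.1 e)) = 1 := by
        rw [Complex.star_def, Complex.mul_conj', norm_fourier_apply]
        simp
      rw [Complex.ofReal_pow, ← Complex.mul_conj', ← Complex.star_def]
      simp only [Y, ContinuousMap.star_apply, ContinuousMap.smul_apply, ContinuousMap.sub_apply,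
        ContinuousMap.const_apply, smul_eq_mul, star_mul', star_sub]
      linear_combination (a e * star (a e)) * h2
    have h2 : ∫ A, star (fourier k) (A.1 e) ∂μ = star (holCoeff μ k e) := by
      simp only [ContinuousMap.star_apply]
      exact integral_conj
    have hi := integrable_continuousMap (μ := μ) (measurable_hol e)
    have h5 : Integrable (fun A : GenConnection M =>
        (1 : ℂ) - holCoeff μ k e * star (fourier k) (A.1 e)) μ :=
      (integrable_const _).sub ((hi _).const_mul _)
    rw [integral_congr_ae (Eventually.of_forall h1),
      integral_sub (h5.const_mul _) ((hi (Y e)).const_mul _), integral_const_mul,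
      integral_const_mul, hY0, integral_sub (integrable_const _) ((hi _).const_mul _),
      integral_const_mul, h2, Complex.star_def, Complex.mul_conj']
    simp only [integral_const, probReal_univ, one_smul, mul_zero, sub_zero]
    rw [Complex.re_ofReal_mul]
    have h3 : ((1 : ℂ) - (‖holCoeff μ k e‖ : ℂ) ^ 2).re ≤ 1 := by
      rw [← Complex.ofReal_pow, Complex.sub_re, Complex.ofReal_re, Complex.one_re]
      linarith [sq_nonneg ‖holCoeff μ k e‖]
    have h4 : ‖a e‖ ^ 2 ≤ 1 := pow_le_one₀ (norm_nonneg _) (ha e)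
    nlinarith [sq_nonneg ‖a e‖]
  have hsum : ∀ A, ((‖fourierSum γ k a (holCoeff μ k) (γ.hol A)‖ ^ 2 : ℝ) : ℂ) =
      ∑ e ∈ γ.edges, ∑ e' ∈ γ.edges, Y e (A.1 e) * star (Y e') (A.1 e') := by
    intro A
    have h1 : fourierSum γ k a (holCoeff μ k) (γ.hol A) = ∑ e ∈ γ.edges, Y e (A.1 e) :=
      Finset.sum_coe_sort γ.edges fun e => Y e (A.1 e)
    rw [← Finset.sum_mul_sum, h1, Complex.ofReal_pow, ← Complex.mul_conj']
    simp only [ContinuousMap.star_apply, ← star_sum]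
    rfl
  have hint : ∀ e e', Integrable (fun A : GenConnection M =>
      Y e (A.1 e) * star (Y e') (A.1 e')) μ := fun e e' =>
    (integrable_continuousMap (measurable_hol e') _).bdd_mul (c := ‖Y e‖)
      ((Y e).continuous.measurable.comp (measurable_hol e)).aestronglyMeasurable
      (Eventually.of_forall fun A => (Y e).norm_coe_le_norm _)
  have hval : ((∫ A, ‖fourierSum γ k a (holCoeff μ k) (γ.hol A)‖ ^ 2 ∂μ : ℝ) : ℂ) =
      ∑ e ∈ γ.edges, ∫ A, Y e (A.1 e) * star (Y e) (A.1 e) ∂μ := by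
    rw [← integral_complex_ofReal]
    simp only [hsum]
    rw [integral_finsetSum _ fun e _ => integrable_finsetSum _ fun e' _ => hint e e']
    refine Finset.sum_congr rfl fun e he => ?_
    rw [integral_finsetSum _ fun e' _ => hint e e']
    -- Off-diagonal terms factor by independence and vanish because `Y e` is centred.
    refine Finset.sum_eq_single_of_mem e he fun e' he' hne => ?_
    rw [hf.integral_mul hne.symm (γ.inter e he e' he' hne.symm), hY0, zero_mul]
  calc ∫ A, ‖fourierSum γ k a (holCoeff μ k) (γ.hol A)‖ ^ 2 ∂μ
      = (∑ e ∈ γ.edges, ∫ A, Y e (A.1 e) * star (Y e) (A.1 e) ∂μ).re := by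
        rw [← hval, Complex.ofReal_re]
    _ ≤ ∑ e ∈ γ.edges, 1 := by
        rw [Complex.re_sum]
        exact Finset.sum_le_sum fun e _ => hYY e
    _ = γ.edges.card := by simp

/-- In a graph whose edges have the same intersection number with an admissible surface,
the Fourier coefficients of the holonomies satisfy an `ℓ¹`-`ℓ²` type estimate. -/
theorem IsAdmissible.sum_norm_holCoeff_le [IsManifold 𝓘(ℝ, E3) ω M] [IsProbabilityMeasure μ]
    {S : Surface M} (hf : IsFactorizing μ f) (hS : IsAdmissible μ S) :
    ∃ C : ℝ, ∀ γ : Graph M, (∀ e ∈ γ.edges, Edge.FinitelyCrosses S e) → ∀ r : ℝ,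
      (∀ e ∈ γ.edges, Edge.intersectionNumber S e = r) → ∀ k : ℤ,
        |r| * |(k : ℝ)| * ∑ e ∈ γ.edges, ‖holCoeff μ k e‖ ≤ C * Real.sqrt γ.edges.card := by
  obtain ⟨C, hC⟩ := hS
  -- The absolute value makes the bound monotone in the norm without discussing the sign of `C`.
  refine ⟨|C|, fun γ hγ r hr k => ?_⟩
  -- The phase that turns each coefficient into its modulus, so that no cancellation occurs in the
  -- flux; division by zero gives 0 where the coefficient vanishes, which is harmless.
  let a : Edge M → ℂ := fun e => star (holCoeff μ k e) / ‖holCoeff μ k e‖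
  have ha : ∀ e, ‖a e‖ ≤ 1 := by
    intro e
    simp only [a, norm_div, norm_star, Complex.norm_real, norm_norm]
    exact div_self_le_one _
  have ham : ∀ e, a e * holCoeff μ k e = ‖holCoeff μ k e‖ := by
    intro e
    rcases eq_or_ne (holCoeff μ k e) 0 with h | h
    · simp [h]
    · have h' : (‖holCoeff μ k e‖ : ℂ) ≠ 0 := by exact_mod_cast norm_ne_zero_iff.2 h
      have h2 : star (holCoeff μ k e) * holCoeff μ k e = (‖holCoeff μ k e‖ : ℂ) ^ 2 :=
        Complex.conj_mul' _
      simp only [a]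
      rw [div_mul_eq_mul_div, h2, pow_two, mul_div_assoc, div_self h', mul_one]
  have h1 := hC γ hγ _ (smoothOnTorus_fourierSum γ k a (holCoeff μ k))
  have h2 : ∫ A, star (Complex.I * fluxField S γ (fourierSum γ k a (holCoeff μ k)) (γ.hol A)) ∂μ =
      star (Complex.I * ((r : ℂ) * (Complex.I * k) * ∑ e ∈ γ.edges, (‖holCoeff μ k e‖ : ℂ))) := by
    have h3 : ∀ A, fluxField S γ (fourierSum γ k a (holCoeff μ k)) (γ.hol A) =
        ∑ e ∈ γ.edges, (r : ℂ) * (a e * (Complex.I * k * fourier k (A.1 e))) := by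
      intro A
      rw [fluxField_fourierSum, ← Finset.sum_coe_sort γ.edges]
      exact Finset.sum_congr rfl fun e _ => by rw [hr e e.2]; rfl
    have h4 : ∫ A, star (Complex.I * fluxField S γ (fourierSum γ k a (holCoeff μ k)) (γ.hol A)) ∂μ
        = star (∫ A, Complex.I * fluxField S γ (fourierSum γ k a (holCoeff μ k)) (γ.hol A) ∂μ) :=
      integral_conj
    have h5 : ∫ A, fluxField S γ (fourierSum γ k a (holCoeff μ k)) (γ.hol A) ∂μ =
        (r : ℂ) * (Complex.I * k) * ∑ e ∈ γ.edges, (‖holCoeff μ k e‖ : ℂ) := by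
      have hi : ∀ e ∈ γ.edges, Integrable (fun A : GenConnection M =>
          (r : ℂ) * (a e * (Complex.I * k * fourier k (A.1 e)))) μ := fun e _ =>
        (((integrable_continuousMap (measurable_hol e) (fourier k)).const_mul _).const_mul
          _).const_mul _
      rw [integral_congr_ae (Eventually.of_forall h3), integral_finsetSum _ hi, Finset.mul_sum]
      refine Finset.sum_congr rfl fun e _ => ?_
      simp only [integral_const_mul]
      rw [← ham e, holCoeff]
      ring
    rw [h4, integral_const_mul, h5]
  rw [h2, norm_star, ← Complex.ofReal_sum] at h1
  simp only [norm_mul, Complex.norm_I, one_mul, Complex.norm_real, Complex.norm_intCast,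
    Real.norm_eq_abs] at h1
  rw [abs_of_nonneg (Finset.sum_nonneg fun e _ => norm_nonneg _)] at h1
  calc _ ≤ _ := h1
    _ ≤ |C| * Real.sqrt (∫ A, ‖fourierSum γ k a (holCoeff μ k) (γ.hol A)‖ ^ 2 ∂μ) := by
        gcongr
        exact le_abs_self C
    _ ≤ _ := by
        gcongr
        exact hf.integral_norm_sq_fourierSum_le γ k a ha

end Estimate

/-! ### Cutting edges into parts, and half-edges at the surface. -/

section Subedges

variable {M : Type*} [TopologicalSpace M] [ChartedSpace E3 M]

theorem mapsTo_affine_I01 {a b : ℝ} (ha : 0 ≤ a) (hab : a < b) (hb : b ≤ 1) :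
    MapsTo (fun t : ℝ => a + (b - a) * t) I01 I01 := by
  rintro t ⟨h0, h1⟩
  constructor <;> nlinarith

theorem velocity_comp_affine {c : ℝ → M} (hc : ContMDiffOn 𝓘(ℝ, ℝ) 𝓘(ℝ, E3) ω c I01)
    {a b : ℝ} (ha : 0 ≤ a) (hab : a < b) (hb : b ≤ 1) {t : ℝ} (ht : t ∈ I01) :
    (velocity (fun t => c (a + (b - a) * t)) t : E3) =
      (b - a) • (velocity c (a + (b - a) * t) : E3) := by
  have hmaps := mapsTo_affine_I01 ha hab hb
  have hu : UniqueMDiffWithinAt 𝓘(ℝ, ℝ) I01 t :=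
    (uniqueDiffOn_Icc_zero_one t ht).uniqueMDiffWithinAt
  have hp : MDifferentiableWithinAt 𝓘(ℝ, ℝ) 𝓘(ℝ, E3) c I01
      ((fun t : ℝ => a + (b - a) * t) t) :=
    (hc _ (hmaps ht)).mdifferentiableWithinAt (by simp)
  have hd : HasDerivAt (fun t : ℝ => a + (b - a) * t) (b - a) t := by
    simpa using ((hasDerivAt_id t).const_mul (b - a)).const_add a
  have hφ := hd.differentiableAt.differentiableWithinAt (s := I01)
  have e2 := mfderivWithin_comp (u := I01) t hp hφ.mdifferentiableWithinAt hmaps hu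
  have e4 : (mfderivWithin 𝓘(ℝ, ℝ) 𝓘(ℝ, ℝ) (fun t : ℝ => a + (b - a) * t) I01 t (1 : ℝ) : ℝ)
      = (b - a) • (1 : ℝ) := by
    rw [mfderivWithin_eq_fderivWithin, smul_eq_mul, mul_one]
    exact hd.hasDerivWithinAt.derivWithin (uniqueDiffOn_Icc_zero_one t ht)
  let L : ℝ →L[ℝ] E3 := mfderivWithin 𝓘(ℝ, ℝ) 𝓘(ℝ, E3) c I01 (a + (b - a) * t)
  exact (congrArg (fun L : ℝ →L[ℝ] E3 => L 1) e2).trans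
    ((congrArg L e4).trans (L.map_smul _ _))

/-- The part of an edge between the parameter values `a` and `b`. -/
def ParamEdge.sub (p : ParamEdge M) (a b : ℝ) (ha : 0 ≤ a) (hab : a < b) (hb : b ≤ 1) :
    ParamEdge M where
  toFun t := p.toFun (a + (b - a) * t)
  analytic := p.analytic.comp
    (contDiff_const.add (contDiff_const.mul contDiff_id)).contMDiff.contMDiffOn
    (mapsTo_affine_I01 ha hab hb)
  velocity_ne t ht h := by
    have h1 := velocity_comp_affine p.analytic ha hab hb ht
    rw [show (velocity (fun t => p.toFun (a + (b - a) * t)) t : E3) = 0 from h] at h1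
    exact p.velocity_ne _ (mapsTo_affine_I01 ha hab hb ht)
      ((smul_eq_zero.1 h1.symm).resolve_left (sub_pos.2 hab).ne')
  simple s hs t ht hst h := by
    have hpos : 0 < b - a := sub_pos.2 hab
    -- A repeated point can only be the closing point of `p`, which forces `a = 0` and `b = 1`.
    obtain ⟨h0, h1⟩ := p.simple _ (mapsTo_affine_I01 ha hab hb hs) _
      (mapsTo_affine_I01 ha hab hb ht) (by nlinarith) h
    have := hs.1
    have := ht.2
    constructor <;> nlinarith

theorem ParamEdge.sub_zero_one (p : ParamEdge M) :
    p.sub 0 1 le_rfl zero_lt_one le_rfl = p := by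
  cases p
  simp [ParamEdge.sub]

theorem ParamEdge.isComp_sub (p : ParamEdge M) {a b c : ℝ} (ha : 0 ≤ a) (hab : a < b)
    (hbc : b < c) (hc : c ≤ 1) :
    Edge.IsComp (p.sub a c ha (hab.trans hbc) hc).edge
      (p.sub a b ha hab (hbc.le.trans hc)).edge
      (p.sub b c (ha.trans hab.le) hbc hc).edge := by
  -- The subdivision parameter is the position of `b` in `[a, c]` rescaled to `[0, 1]`.
  have hac : 0 < c - a := by linarith
  refine ⟨_, _, _, rfl, rfl, rfl, (b - a) / (c - a), ⟨by apply div_pos <;> linarith, ?_⟩,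
    fun s _ => ⟨?_, ?_⟩⟩
  · rw [div_lt_one hac]
    linarith
  · simp only [ParamEdge.sub]
    congr 1
    field_simp
  · simp only [ParamEdge.sub]
    congr 1
    field_simp
    ring

theorem ParamEdge.image_sub (p : ParamEdge M) {a b : ℝ} (ha : 0 ≤ a) (hab : a < b) (hb : b ≤ 1) :
    (p.sub a b ha hab hb).edge.image = p.toFun '' Icc a b := by
  change (fun t => p.toFun (a + (b - a) * t)) '' I01 = _
  have hpos : 0 < b - a := sub_pos.2 hab
  ext x
  constructor
  · rintro ⟨t, ⟨h0, h1⟩, rfl⟩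
    exact ⟨a + (b - a) * t, ⟨by nlinarith, by nlinarith⟩, rfl⟩
  · rintro ⟨t, ⟨h0, h1⟩, rfl⟩
    refine ⟨(t - a) / (b - a), ⟨div_nonneg (by linarith) hpos.le, ?_⟩, ?_⟩
    · rw [div_le_one hpos]
      linarith
    · simp only []
      congr 1
      field_simp
      ring

theorem ParamEdge.endpoints_sub (p : ParamEdge M) {a b : ℝ} (ha : 0 ≤ a) (hab : a < b)
    (hb : b ≤ 1) : (p.sub a b ha hab hb).edge.endpoints = {p.toFun a, p.toFun b} := by
  change {p.toFun (a + (b - a) * 0), p.toFun (a + (b - a) * 1)} = _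
  simp

/-- Consecutive parts of an edge meet at most in their endpoints. -/
theorem ParamEdge.image_sub_inter_subset (p : ParamEdge M) {a b c : ℝ} (ha : 0 ≤ a) (hab : a < b)
    (hbc : b < c) (hc : c ≤ 1) :
    (p.sub a b ha hab (hbc.le.trans hc)).edge.image ∩
        (p.sub b c (ha.trans hab.le) hbc hc).edge.image ⊆
      (p.sub a b ha hab (hbc.le.trans hc)).edge.endpoints ∩
        (p.sub b c (ha.trans hab.le) hbc hc).edge.endpoints := by
  rw [p.image_sub, p.image_sub, p.endpoints_sub, p.endpoints_sub]
  rintro _ ⟨⟨s, ⟨hs0, hs1⟩, rfl⟩, ⟨t, ⟨ht0, ht1⟩, h⟩⟩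
  rcases (hs1.trans ht0).eq_or_lt with hst | hst
  · obtain rfl : s = b := le_antisymm hs1 (hst ▸ ht0)
    simp
  · obtain ⟨h0, h1⟩ := p.simple s ⟨by linarith, by linarith⟩ t ⟨by linarith, by linarith⟩ hst h.symm
    obtain rfl : s = a := by linarith
    obtain rfl : t = c := by linarith
    rw [← h]
    simp [h]

/-- An edge has more than one point. -/
theorem ParamEdge.nontrivial_image (p : ParamEdge M) : p.edge.image.Nontrivial := by
  refine ⟨p.toFun 0, ⟨0, by simp, rfl⟩, p.toFun (1 / 2), ⟨1 / 2, by constructor <;> norm_num, rfl⟩,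
    fun h => ?_⟩
  have := (p.simple 0 (by simp) (1 / 2) (by constructor <;> norm_num) (by norm_num) h).2
  norm_num at this

variable {μ : Measure (GenConnection M)} {f : Edge M → U1 → ℝ}

theorem IsFactorizing.holCoeff_sub (hf : IsFactorizing μ f) (p : ParamEdge M) (k : ℤ) {a b c : ℝ}
    (ha : 0 ≤ a) (hab : a < b) (hbc : b < c) (hc : c ≤ 1) :
    holCoeff μ k (p.sub a c ha (hab.trans hbc) hc).edge =
      holCoeff μ k (p.sub a b ha hab (hbc.le.trans hc)).edge *
        holCoeff μ k (p.sub b c (ha.trans hab.le) hbc hc).edge := by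
  refine hf.holCoeff_mul (p.isComp_sub ha hab hbc hc) (fun h => ?_)
    (p.image_sub_inter_subset ha hab hbc hc) k
  -- The midpoint of `[a, b]` tells the parts apart: its parameter is positive, so `p` does not
  -- return to it later.
  have h1 : p.toFun ((a + b) / 2) ∈ (p.sub a b ha hab (hbc.le.trans hc)).edge.image := by
    rw [p.image_sub]
    exact ⟨_, ⟨by linarith, by linarith⟩, rfl⟩
  rw [h, p.image_sub] at h1
  obtain ⟨t, ⟨ht0, ht1⟩, h2⟩ := h1
  have := (p.simple ((a + b) / 2) ⟨by linarith, by linarith⟩ t ⟨by linarith, by linarith⟩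
    (by linarith) h2.symm).1
  linarith

/-- Restricting to a part of an edge can only increase the Fourier coefficients. -/
theorem IsFactorizing.norm_holCoeff_le_sub [IsProbabilityMeasure μ] (hf : IsFactorizing μ f)
    (p : ParamEdge M) (k : ℤ) {a b : ℝ} (ha : 0 ≤ a) (hab : a < b) (hb : b ≤ 1) :
    ‖holCoeff μ k p.edge‖ ≤ ‖holCoeff μ k (p.sub a b ha hab hb).edge‖ := by
  have h1 : ‖holCoeff μ k (p.sub a 1 ha (hab.trans_le hb) le_rfl).edge‖ ≤
      ‖holCoeff μ k (p.sub a b ha hab hb).edge‖ := by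
    rcases hb.eq_or_lt with rfl | hb'
    · rfl
    · rw [hf.holCoeff_sub p k ha hab hb' le_rfl, norm_mul]
      exact mul_le_of_le_one_right (norm_nonneg _) (norm_holCoeff_le_one k _)
  refine le_trans ?_ h1
  conv_lhs => rw [← p.sub_zero_one]
  rcases ha.eq_or_lt with rfl | ha'
  · rfl
  · rw [hf.holCoeff_sub p k le_rfl ha' (hab.trans_le hb) le_rfl, norm_mul]
    exact mul_le_of_le_one_left (norm_nonneg _) (norm_holCoeff_le_one k _)

theorem Surface.orient_sub (S : Surface M) (p : ParamEdge M) {a b : ℝ} (ha : 0 ≤ a) (hab : a < b)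
    (hb : b ≤ 1) {t : ℝ} (ht : t ∈ I01) :
    S.orient (p.sub a b ha hab hb).toFun t = S.orient p.toFun (a + (b - a) * t) := by
  have h := velocity_comp_affine p.analytic ha hab hb ht
  let L : E3 →L[ℝ] ℝ := S.conormal (p.toFun (a + (b - a) * t))
  have h1 : L (velocity (fun t => p.toFun (a + (b - a) * t)) t) =
      (b - a) * L (velocity p.toFun (a + (b - a) * t)) :=
    (congrArg L h).trans (L.map_smul _ _)
  change SignType.sign (L (velocity (fun t => p.toFun (a + (b - a) * t)) t)) =
    SignType.sign (L (velocity p.toFun (a + (b - a) * t)))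
  rw [h1, sign_mul, sign_pos (sub_pos.2 hab), one_mul]

variable [IsManifold 𝓘(ℝ, E3) ω M]

/-- An edge which meets the surface only in one of its ends has intersection number `±1/2`. -/
theorem ParamEdge.intersectionNumber_of_end (S : Surface M) (q : ParamEdge M) {s : SignType}
    (hs : s ≠ 0) {r : ℝ} (hr : r ∈ ({0, 1} : Set ℝ))
    (hq : ∀ t ∈ I01, q.toFun t ∈ S.carrier ↔ t = r) (ho : S.orient q.toFun r = s) :
    q.edge.FinitelyCrosses S ∧ q.edge.intersectionNumber S = (s : ℝ) / 2 := by
  have hsub : ({0, 1} : Set ℝ) ⊆ I01 := by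
    rintro t (rfl | rfl) <;> simp
  have hcr : ∀ J ⊆ I01, ∀ s', S.crossings J s' q.toFun = {t ∈ J | t = r ∧ s = s'} := by
    intro J hJ s'
    ext t
    refine ⟨fun ⟨h1, h2, h3⟩ => ?_, fun ⟨h1, h2, h3⟩ => ?_⟩
    · have := (hq t (hJ h1)).1 h2
      subst this
      exact ⟨h1, rfl, ho.symm.trans h3⟩
    · subst h2
      exact ⟨h1, (hq t (hJ h1)).2 rfl, ho.trans h3⟩
  have hproper : ∀ s', q.edge.numProper S s' = 0 := by
    intro s'
    change (S.crossings (Ioo 0 1) s' q.toFun).ncard = 0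
    rw [hcr _ Ioo_subset_Icc_self, show {t ∈ Ioo (0 : ℝ) 1 | t = r ∧ s = s'} = ∅ from ?_,
      ncard_empty]
    refine eq_empty_of_forall_notMem ?_
    rintro _ ⟨⟨h0, h1⟩, rfl, -⟩
    rcases hr with rfl | rfl
    · exact h0.false
    · exact h1.false
  have himproper : ∀ s', q.edge.numImproper S s' = if s = s' then 1 else 0 := by
    intro s'
    change (S.crossings {0, 1} s' q.toFun).ncard = _
    rw [hcr _ hsub]
    split_ifs with h
    · rw [show {t ∈ ({0, 1} : Set ℝ) | t = r ∧ s = s'} = {r} from ?_, ncard_singleton]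
      ext t
      exact ⟨fun ht => ht.2.1, fun ht => by rw [mem_singleton_iff] at ht; exact ⟨ht ▸ hr, ht, h⟩⟩
    · rw [show {t ∈ ({0, 1} : Set ℝ) | t = r ∧ s = s'} = ∅ from ?_, ncard_empty]
      exact eq_empty_of_forall_notMem fun t ht => h ht.2.2
  constructor
  · change (S.crossings I01 1 q.toFun).Finite ∧ (S.crossings I01 (-1) q.toFun).Finite
    have : ∀ s', (S.crossings I01 s' q.toFun).Finite := fun s' => by
      rw [hcr _ Subset.rfl]
      exact (finite_singleton r).subset fun t ht => ht.2.1
    exact ⟨this 1, this (-1)⟩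
  · unfold Edge.intersectionNumber
    rw [hproper, hproper, himproper, himproper]
    cases s
    · exact absurd rfl hs
    · norm_num
    · norm_num

/-- Near the point at which an edge meets the surface, there are arbitrarily small parts of the
edge which meet the surface only in one of their ends. -/
theorem Edge.MeetsOnce.exists_halfEdge [IsProbabilityMeasure μ] (hf : IsFactorizing μ f)
    {S : Surface M} {s : SignType} (hs : s ≠ 0) {e : Edge M} (he : e.MeetsOnce S s) {x : M}
    (hx : e.image ∩ S.carrier = {x}) {U : Set M} (hU : U ∈ 𝓝 x) :
    ∃ h : Edge M, h.image ⊆ e.image ∩ U ∧ x ∈ h.endpoints ∧ h.image.Nontrivial ∧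
      h.FinitelyCrosses S ∧ h.intersectionNumber S = (s : ℝ) / 2 ∧
      ∀ k, ‖holCoeff μ k e‖ ≤ ‖holCoeff μ k h‖ := by
  obtain ⟨p, rfl⟩ : ∃ p : ParamEdge M, p.edge = e := Quotient.exists_rep e
  have hxm : x ∈ p.edge.image ∩ S.carrier := hx ▸ mem_singleton x
  have hor : ∀ t ∈ I01, p.toFun t ∈ S.carrier → S.orient p.toFun t = s := he.2
  obtain ⟨⟨t₀, ht₀, rfl⟩, hxS⟩ := hxm
  have hmeet : ∀ t ∈ I01, p.toFun t ∈ S.carrier → p.toFun t = p.toFun t₀ := fun t ht htS => by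
    have : p.toFun t ∈ p.edge.image ∩ S.carrier := ⟨⟨t, ht, rfl⟩, htS⟩
    rwa [hx] at this
  obtain ⟨ε, hε, hball⟩ := Metric.mem_nhdsWithin_iff.1
    ((p.analytic.continuousOn t₀ ht₀) hU)
  have hsubset : ∀ a b : ℝ, 0 ≤ a → b ≤ 1 → t₀ - ε < a → b < t₀ + ε →
      p.toFun '' Icc a b ⊆ p.edge.image ∩ U := by
    rintro a b ha hb ha' hb' _ ⟨t, ⟨h0, h1⟩, rfl⟩
    have ht : t ∈ I01 := ⟨ha.trans h0, h1.trans hb⟩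
    refine ⟨⟨t, ht, rfl⟩, hball ⟨?_, ht⟩⟩
    rw [Metric.mem_ball, Real.dist_eq, abs_lt]
    constructor <;> linarith
  -- Here `r` says whether the part starts (`0`) or ends (`1`) on the surface. The relative
  -- orientation is `s` in both cases, so the intersection number does not depend on `r`.
  have key : ∀ a b : ℝ, ∀ (ha : 0 ≤ a) (hab : a < b) (hb : b ≤ 1), t₀ - ε < a → b < t₀ + ε →
      ∀ r ∈ ({0, 1} : Set ℝ), a + (b - a) * r = t₀ →
      (∀ t ∈ I01, p.toFun (a + (b - a) * t) = p.toFun t₀ → t = r) →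
      ∃ h : Edge M, h.image ⊆ p.edge.image ∩ U ∧ p.toFun t₀ ∈ h.endpoints ∧ h.image.Nontrivial ∧
        h.FinitelyCrosses S ∧ h.intersectionNumber S = (s : ℝ) / 2 ∧
        ∀ k, ‖holCoeff μ k p.edge‖ ≤ ‖holCoeff μ k h‖ := by
    intro a b ha hab hb ha' hb' r hr hrt huniq
    have hrI : r ∈ I01 := by
      rcases hr with rfl | rfl <;> simp
    have hnum := (p.sub a b ha hab hb).intersectionNumber_of_end S hs hr
      (fun t ht => ⟨fun h => huniq t ht (hmeet _ (mapsTo_affine_I01 ha hab hb ht) h), fun h => by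
        rw [h]
        change p.toFun (a + (b - a) * r) ∈ S.carrier
        rwa [hrt]⟩)
      (by rw [S.orient_sub p ha hab hb hrI, hrt]; exact hor t₀ ht₀ hxS)
    refine ⟨(p.sub a b ha hab hb).edge, ?_, ?_, ParamEdge.nontrivial_image _, hnum.1, hnum.2,
      fun k => hf.norm_holCoeff_le_sub p k ha hab hb⟩
    · rw [p.image_sub]
      exact hsubset a b ha hb ha' hb'
    · rw [p.endpoints_sub, ← hrt]
      rcases hr with rfl | rfl <;> simp
  rcases ht₀.2.lt_or_eq with hlt | heq
  · have hδ : 0 < min (ε / 2) ((1 - t₀) / 2) := lt_min (by linarith) (by linarith)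
    have hδ1 := min_le_left (ε / 2) ((1 - t₀) / 2)
    have hδ2 := min_le_right (ε / 2) ((1 - t₀) / 2)
    set δ := min (ε / 2) ((1 - t₀) / 2)
    refine key t₀ (t₀ + δ) ht₀.1 (by linarith) (by linarith) (by linarith) (by linarith) 0
      (by simp) (by ring) fun t ht h => ?_
    by_contra hne
    have htpos : 0 < t := lt_of_le_of_ne ht.1 (Ne.symm hne)
    have hmul : (t₀ + δ - t₀) * t ≤ δ := by nlinarith [ht.2]
    have hmul' : 0 < (t₀ + δ - t₀) * t := mul_pos (by linarith) htpos
    have := (p.simple t₀ ht₀ _ ⟨by linarith [ht₀.1], by linarith⟩ (by linarith) h.symm).2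
    linarith
  · have hδ : 0 < min (ε / 2) (1 / 2 : ℝ) := lt_min (by linarith) (by norm_num)
    have hδ1 := min_le_left (ε / 2) (1 / 2 : ℝ)
    have hδ2 := min_le_right (ε / 2) (1 / 2 : ℝ)
    set δ := min (ε / 2) (1 / 2 : ℝ)
    refine key (t₀ - δ) t₀ (by linarith) (by linarith) ht₀.2 (by linarith) (by linarith) 1
      (by simp) (by ring) fun t ht h => ?_
    by_contra hne
    have htlt : t < 1 := lt_of_le_of_ne ht.2 hne
    have hmul : (t₀ - (t₀ - δ)) * t < δ := by nlinarith
    have hmul' : 0 ≤ (t₀ - (t₀ - δ)) * t := mul_nonneg (by linarith) ht.1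
    have := (p.simple _ ⟨by linarith, by linarith⟩ t₀ ht₀ (by linarith) h).1
    linarith

end Subedges

/-! ### The graph of half-edges and the counting argument. -/

section Countability

variable {M : Type*} [TopologicalSpace M] [ChartedSpace E3 M] [IsManifold 𝓘(ℝ, E3) ω M]
  {μ : Measure (GenConnection M)} {f : Edge M → U1 → ℝ} [IsProbabilityMeasure μ]

/-- Finitely many edges which meet the surface once and do not overlap near it have parts which form
a graph, all of whose edges have intersection number `s / 2` with the surface. -/
theorem IsFactorizing.exists_graph_of_meetsOnce (hf : IsFactorizing μ f) {S : Surface M}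
    {s : SignType} (hs : s ≠ 0) (T : Finset (Edge M)) (hmeet : ∀ e ∈ T, e.MeetsOnce S s)
    (hover : (T : Set (Edge M)).Pairwise fun e e' => ¬ Edge.OverlapNear S e e') :
    ∃ (γ : Graph M) (h : Edge M → Edge M), InjOn h T ∧ (γ.edges : Set (Edge M)) = h '' T ∧
      (∀ e ∈ γ.edges, e.FinitelyCrosses S) ∧
      (∀ e ∈ γ.edges, e.intersectionNumber S = (s : ℝ) / 2) ∧
      ∀ e ∈ T, ∀ k, ‖holCoeff μ k e‖ ≤ ‖holCoeff μ k (h e)‖ := by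
  classical
  have hpart : ∀ e, ∃ (x : M) (h : Edge M), e ∈ T → e.image ∩ S.carrier = {x} ∧
      h.image ⊆ e.image ∩ ⋂ e' ∈ T.erase e, (closure ((e.image ∩ e'.image) \ S.carrier))ᶜ ∧
      x ∈ h.endpoints ∧ h.image.Nontrivial ∧ h.FinitelyCrosses S ∧
      h.intersectionNumber S = (s : ℝ) / 2 ∧ ∀ k, ‖holCoeff μ k e‖ ≤ ‖holCoeff μ k h‖ := by
    intro e
    by_cases he : e ∈ T
    swap
    · obtain ⟨p, -⟩ := Quotient.exists_rep e
      exact ⟨p.toFun 0, e, fun h => absurd h he⟩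
    obtain ⟨x, hx⟩ := (hmeet e he).1
    have hxS : x ∈ S.carrier := (hx ▸ mem_singleton x : x ∈ e.image ∩ S.carrier).2
    obtain ⟨h, hh⟩ := (hmeet e he).exists_halfEdge hf hs hx
      (U := ⋂ e' ∈ T.erase e, (closure ((e.image ∩ e'.image) \ S.carrier))ᶜ) (by
        -- Not overlapping near `S` says that `x` avoids each of these closures; `T` being finite, a
        -- whole neighbourhood avoids them all.
        refine (Filter.biInter_finset_mem _).2 fun e' he' => ?_
        refine isClosed_closure.isOpen_compl.mem_nhds fun hcl => ?_
        exact hover he (Finset.mem_of_mem_erase he') (Finset.ne_of_mem_erase he').symm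
          ⟨x, hxS, hcl⟩)
    exact ⟨x, h, fun _ => ⟨hx, hh⟩⟩
  choose x h hx him hend hnt hfin hnum hcoeff using hpart
  have hinter : ∀ e ∈ T, ∀ e' ∈ T, e ≠ e' →
      ∀ y ∈ (h e).image ∩ (h e').image, y = x e ∧ y = x e' := by
    rintro e he e' he' hne y ⟨hy, hy'⟩
    have h1 := him e he hy
    have h2 := him e' he' hy'
    -- The half-edge of `e` was confined to a region free of common points with `e'` off `S`, so a
    -- common point lies on `S` and is the only point of either edge there.
    have hyS : y ∈ S.carrier := by
      by_contra hyS
      exact mem_iInter₂.1 h1.2 e' (Finset.mem_erase.2 ⟨hne.symm, he'⟩)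
        (subset_closure ⟨⟨h1.1, h2.1⟩, hyS⟩)
    have h3 : y ∈ e.image ∩ S.carrier := ⟨h1.1, hyS⟩
    have h4 : y ∈ e'.image ∩ S.carrier := ⟨h2.1, hyS⟩
    rw [hx e he] at h3
    rw [hx e' he'] at h4
    exact ⟨h3, h4⟩
  have hinj : InjOn h T := by
    intro e he e' he' heq
    by_contra hne
    -- Equal half-edges would consist of the single point `x e`.
    obtain ⟨y, hy, z, hz, hyz⟩ := hnt e he
    exact hyz ((hinter e he e' he' hne y ⟨hy, heq ▸ hy⟩).1.trans
      (hinter e he e' he' hne z ⟨hz, heq ▸ hz⟩).1.symm)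
  refine ⟨⟨T.image h, ?_⟩, h, hinj, Finset.coe_image, ?_, ?_, hcoeff⟩
  · intro a ha b hb hab y hy
    obtain ⟨e, he, rfl⟩ := Finset.mem_image.1 ha
    obtain ⟨e', he', rfl⟩ := Finset.mem_image.1 hb
    obtain ⟨h1, h2⟩ := hinter e he e' he' (fun heq => hab (heq ▸ rfl)) y hy
    exact ⟨h1 ▸ hend e he, h2 ▸ hend e' he'⟩
  · exact Finset.forall_mem_image.2 hfin
  · exact Finset.forall_mem_image.2 hnum

/-- For `N` edges of this set the estimate on their half-edges reads `N ε / 2 ≤ C √N`, hence `N ≤ (2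
C / ε)²`; infinitely many edges would provide a larger `N`. -/
theorem IsAdmissible.finite_setOf_le_norm_holCoeff (hf : IsFactorizing μ f) {S : Surface M}
    (hS : IsAdmissible μ S) {s : SignType} (hs : s ≠ 0) {𝓔 : Set (Edge M)}
    (hmeet : ∀ e ∈ 𝓔, e.MeetsOnce S s)
    (hover : 𝓔.Pairwise fun e e' => ¬ Edge.OverlapNear S e e') {k : ℤ} (hk : k ≠ 0)
    {ε : ℝ} (hε : 0 < ε) : {e ∈ 𝓔 | ε ≤ ‖holCoeff μ k e‖}.Finite := by
  obtain ⟨C, hC⟩ := hS.sum_norm_holCoeff_le hf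
  by_contra hinf
  obtain ⟨N, hN⟩ := exists_nat_gt ((2 * C / ε) ^ 2)
  obtain ⟨T, hT, hcard⟩ := Set.Infinite.exists_subset_card_eq hinf N
  obtain ⟨γ, h, hinj, hγ, hfin, hnum, hle⟩ := hf.exists_graph_of_meetsOnce hs T
    (fun e he => hmeet e (hT he).1) (hover.mono fun e he => (hT he).1)
  classical
  have hγ' : γ.edges = T.image h := by
    rw [← Finset.coe_inj, hγ, Finset.coe_image]
  have hNpos : (0 : ℝ) < N := lt_of_le_of_lt (sq_nonneg _) hN
  have h1 := hC γ hfin _ hnum k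
  have h2 : N * ε ≤ ∑ e ∈ γ.edges, ‖holCoeff μ k e‖ := by
    rw [hγ', Finset.sum_image hinj, ← hcard, ← nsmul_eq_mul]
    exact Finset.card_nsmul_le_sum _ _ _ fun e he => (hT he).2.trans (hle e he k)
  have h3 : |(s : ℝ) / 2| = 1 / 2 := by
    cases s
    · exact absurd rfl hs
    · norm_num [abs_div]
    · norm_num [abs_div]
  have h4 : (1 : ℝ) ≤ |(k : ℝ)| := by exact_mod_cast Int.one_le_abs hk
  rw [h3, hγ', Finset.card_image_of_injOn hinj, hcard] at h1
  rw [hγ'] at h2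
  have hsq : Real.sqrt N * Real.sqrt N = N := Real.mul_self_sqrt hNpos.le
  have hsqpos : 0 < Real.sqrt N := Real.sqrt_pos.2 hNpos
  have h5 : 1 / 2 * (N * ε) ≤ C * Real.sqrt N := by
    refine le_trans ?_ h1
    have : 0 ≤ N * ε := by positivity
    -- The factor `|k| ≥ 1` is discarded here, so the bound on `N` is uniform in `k`.
    nlinarith [mul_le_mul h4 h2 this (abs_nonneg _)]
  have h6 : Real.sqrt N ≤ 2 * C / ε := by
    rw [le_div_iff₀ hε]
    refine le_of_mul_le_mul_right ?_ hsqpos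
    nlinarith
  have h7 : (N : ℝ) ≤ (2 * C / ε) ^ 2 := by
    rw [← hsq, ← pow_two]
    exact pow_le_pow_left₀ hsqpos.le h6 2
  exact absurd hN h7.not_gt

end Countability

end GenU1

end

theorem mainTheorem3 {M : Type*} [TopologicalSpace M] [T2Space M] [ConnectedSpace M]
    [ChartedSpace GenU1.E3 M] [IsManifold 𝓘(ℝ, GenU1.E3) ω M]
    (μ : Measure (GenU1.GenConnection M)) [IsProbabilityMeasure μ]
    (f : GenU1.Edge M → GenU1.U1 → ℝ) (hf : GenU1.IsFactorizing μ f)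
    (S : GenU1.Surface M) (hS : GenU1.IsAdmissible μ S)
    (s : SignType) (hs : s ≠ 0)
    (𝓔 : Set (GenU1.Edge M)) (hmeet : ∀ e ∈ 𝓔, GenU1.Edge.MeetsOnce S s e)
    (hover : 𝓔.Pairwise fun e e' => ¬ GenU1.Edge.OverlapNear S e e') :
    {e ∈ 𝓔 | ¬ f e =ᵐ[(AddCircle.haarAddCircle : Measure GenU1.U1)] fun _ => 1}.Countable := by
  have hfin : ∀ (k : {k : ℤ // k ≠ 0}) (n : ℕ),
      {e ∈ 𝓔 | 1 / ((n : ℝ) + 1) ≤ ‖GenU1.holCoeff μ k e‖}.Finite := fun k n =>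
    hS.finite_setOf_le_norm_holCoeff hf hs hmeet hover k.2 Nat.one_div_pos_of_nat
  -- Each exceptional edge has a nonzero coefficient of some order `k ≠ 0`, of modulus above some `1
  -- / (n + 1)`; the pairs `(k, n)` are countable.
  refine (countable_iUnion fun k => countable_iUnion fun n => (hfin k n).countable).mono ?_
  rintro e ⟨he, hne⟩
  have : ∃ k : ℤ, k ≠ 0 ∧ GenU1.holCoeff μ k e ≠ 0 := by
    by_contra! h
    exact hne (hf.density_eq_one h)
  obtain ⟨k, hk, hke⟩ := this
  obtain ⟨n, hn⟩ := exists_nat_one_div_lt (norm_pos_iff.2 hke)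
  exact mem_iUnion.2 ⟨⟨k, hk⟩, mem_iUnion.2 ⟨n, he, hn.le⟩⟩
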